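/- Let $d\in\mathbb{N}$, $c>0$, $A_1,A_2:[0,\infty)\to\mathbb{R}^{d\times d}$, $b_1,b_2:[0,\infty)\to\mathbb{R}^d$ and $\sigma:\mathbb{R}\to\mathbb{R}$, where $\sigma$ is applied element-wise to vectors. Write $\mathbb{R}^d_+=\{x\in\mathbb{R}^d: x_i\ge 0 \text{ for all } i\}$, let $\mathcal{N}_{\mathbb{R}^d_+}(x)=\{\xi\in\mathbb{R}^d:\langle\xi,y-x\rangle\le 0\text{ for all }y\in\mathbb{R}^d_+\}$ for $x\in\mathbb{R}^d_+$ and $\mathcal{N}_{\mathbb{R}^d_+}(x)=\emptyset$ for $x\notin\mathbb{R}^d_+$ (the subdifferential of the indicator function of $\mathbb{R}^d_+$), and put $$F(t,x)=A_2(t)\,\sigma(A_1(t)x+b_1(t))-b_2(t).$$ Assume that $\|A_1(t)\|_2\,\|A_2(t)\|_2\le c$ for all $t>0$ ($\ell^2$ operator norms), that $\sigma$ is contractive, i.e. $|\sigma(r)-\sigma(s)|\le|r-s|$ for all $r,s\in\mathbb{R}$, with $\sigma(0)=0$, and that for each fixed $x\in\mathbb{R}^d$ the function $t\mapsto F(t,x)$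 is measurable and locally integrable on $[0,\infty)$ (this holds, for example, if $A_1,A_2,b_1,b_2$ are measurable and $\|A_2\|_2\|b_1\|_2+\|b_2\|_2$ is integrable on $[0,T]$ for every $T>0$). Then for every $x_0\in\mathbb{R}^d_+$ the problem $$-\frac{d}{dt}x(t)\in\mathcal{N}_{\mathbb{R}^d_+}(x(t))+A_2(t)\,\sigma(A_1(t)x(t)+b_1(t))-b_2(t)\quad\text{for a.e. }t>0,\qquad x(0)=x_0,$$ has one and only one solution $x:[0,\infty)\to\mathbb{R}^d$ that is absolutely continuous on $[0,T]$ for every $T>0$, and this solution satisfies $x(t)\in\mathbb{R}^d_+$ for all $t\ge 0$. -/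

import Mathlib

open MeasureTheory Set
open scoped Pointwise

noncomputable section

namespace ResNet

/-- The nonnegative orthant `ℝᵈ₊`. -/
def orthant (d : ℕ) : Set (EuclideanSpace ℝ (Fin d)) := {x | ∀ i, 0 ≤ x i}

/-- The normal cone of convex analysis, i.e. the subdifferential of the `0`/`∞` indicator function
of `S`. As usual it is empty at points outside `S`. -/
def normalCone {d : ℕ} (S : Set (EuclideanSpace ℝ (Fin d))) (x : EuclideanSpace ℝ (Fin d)) :
    Set (EuclideanSpace ℝ (Fin d)) :=
  {ξ | x ∈ S ∧ ∀ y ∈ S, inner ℝ ξ (y - x) ≤ 0}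

/-- The operator of a matrix on Euclidean space; its norm is the `ℓ²` operator norm. -/
abbrev op {d : ℕ} (A : Matrix (Fin d) (Fin d) ℝ) :
    EuclideanSpace ℝ (Fin d) →L[ℝ] EuclideanSpace ℝ (Fin d) :=
  Matrix.toEuclideanCLM (n := Fin d) (𝕜 := ℝ) A

/-- The activation `σ` applied element-wise. -/
def act {d : ℕ} (σ : ℝ → ℝ) (z : EuclideanSpace ℝ (Fin d)) : EuclideanSpace ℝ (Fin d) :=
  WithLp.toLp 2 (fun i => σ (z i))

/-- The forcing `F(t, x) = A₂(t) σ(A₁(t) x + b₁(t)) - b₂(t)`. -/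
def forcing {d : ℕ} (A₁ A₂ : ℝ → Matrix (Fin d) (Fin d) ℝ) (b₁ b₂ : ℝ → EuclideanSpace ℝ (Fin d))
    (σ : ℝ → ℝ) (t : ℝ) (x : EuclideanSpace ℝ (Fin d)) : EuclideanSpace ℝ (Fin d) :=
  op (A₂ t) (act σ (op (A₁ t) x + b₁ t)) - b₂ t

/-- `x` restricted to `[0, ∞)` is an absolutely continuous solution (absolutely continuous on every
`[0, T]`) of `-x'(t) ∈ N(x(t)) + F(t, x(t))` for a.e. `t > 0`, `x(0) = x₀`, with `N` the normal cone
of the orthant. Only the values of `x` and `F` at times `t ≥ 0` matter. -/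
structure IsSolution {d : ℕ} (F : ℝ → EuclideanSpace ℝ (Fin d) → EuclideanSpace ℝ (Fin d))
    (x₀ : EuclideanSpace ℝ (Fin d)) (x : ℝ → EuclideanSpace ℝ (Fin d)) : Prop where
  absolutelyContinuous : ∀ T : ℝ, 0 < T → AbsolutelyContinuousOnInterval x 0 T
  inclusion : ∀ᵐ t ∂(volume.restrict (Ioi (0 : ℝ))),
    ∃ v, HasDerivAt x v t ∧ -v ∈ normalCone (orthant d) (x t) + {F t (x t)}
  initial : x 0 = x₀

end ResNet

end

/-!
When the forcing `f` depends on time only, the problem is the Skorokhod reflection problem: pushing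
every coordinate of the free path `x₀ - ∫ f` upwards by the running supremum of its negative part
solves it explicitly, because a coordinate is pushed only while it vanishes. This reflection is
Lipschitz for the uniform norm on `[0, t]`, so for a forcing that is Lipschitz in space the fixed
points of a Volterra operator are solutions, and its Picard iterates converge because the `n`-th
increment is `O(Cⁿ tⁿ / n!)`. Uniqueness comes from the monotonicity of the normal cone: two
solutions satisfy `⟪x - y, x' - y'⟫ ≤ c ‖x - y‖²`, so `exp (-c t) ‖x - y‖` is nonincreasing.
-/

open Filter Function Topology
open scoped Nat NNReal Interval

namespace ResNet

section Analysis

lemma absolutelyContinuousOnInterval_of_dist_le {X Y : Type*} [PseudoMetricSpace X]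
    [PseudoMetricSpace Y] {f : ℝ → X} {g : ℝ → Y} {a b C : ℝ}
    (hg : AbsolutelyContinuousOnInterval g a b)
    (hfg : ∀ s ∈ uIcc a b, ∀ t ∈ uIcc a b, dist (f s) (f t) ≤ C * dist (g s) (g t)) :
    AbsolutelyContinuousOnInterval f a b := by
  refine squeeze_zero' (.of_forall fun _ => Finset.sum_nonneg fun _ _ => dist_nonneg) ?_
    (by simpa using Tendsto.const_mul C hg)
  filter_upwards [mem_inf_of_right (mem_principal_self _)] with I hI
  rw [Finset.mul_sum]
  exact Finset.sum_le_sum fun i hi => hfg _ (hI.1 i hi).1 _ (hI.1 i hi).2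

lemma le_of_ae_hasDerivAt_nonpos {q : ℝ → ℝ} {a b : ℝ} (hab : a ≤ b)
    (hq : AbsolutelyContinuousOnInterval q a b)
    (hq' : ∀ᵐ t ∂volume.restrict (Ioc a b), ∃ v ≤ 0, HasDerivAt q v t) : q b ≤ q a := by
  rw [← sub_nonpos, ← hq.integral_deriv_eq_sub, intervalIntegral.integral_of_le hab]
  refine integral_nonpos_of_ae ?_
  filter_upwards [hq'] with t ⟨v, hv, hd⟩
  exact hd.deriv.trans_le hv

lemma norm_le_exp_mul_norm_of_ae_inner_deriv_le {E : Type*} [NormedAddCommGroup E]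
    [InnerProductSpace ℝ E] {z : ℝ → E} {a b c : ℝ} (hab : a ≤ b)
    (hz : AbsolutelyContinuousOnInterval z a b)
    (hz' : ∀ᵐ t ∂volume.restrict (Ioc a b),
      ∃ v, HasDerivAt z v t ∧ inner ℝ (z t) v ≤ c * ‖z t‖ ^ 2) :
    ‖z b‖ ≤ Real.exp (c * (b - a)) * ‖z a‖ := by
  let w (t : ℝ) := Real.exp (2 * (c * (b - t)))
  have hnorm : AbsolutelyContinuousOnInterval (fun t => ‖z t‖) a b :=
    absolutelyContinuousOnInterval_of_dist_le (C := 1) hz fun s _ t _ => by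
      rw [one_mul, dist_eq_norm (z s)]
      exact dist_norm_norm_le _ _
  have hw : AbsolutelyContinuousOnInterval w a b :=
    ContDiffOn.absolutelyContinuousOnInterval (by fun_prop)
  have hq : AbsolutelyContinuousOnInterval (fun t => w t * ‖z t‖ ^ 2) a b := by
    simpa only [sq] using hw.fun_mul (hnorm.fun_mul hnorm)
  have hle : w b * ‖z b‖ ^ 2 ≤ w a * ‖z a‖ ^ 2 := by
    refine le_of_ae_hasDerivAt_nonpos hab hq ?_
    filter_upwards [hz'] with t ⟨v, hv, hvz⟩
    have hw' : HasDerivAt w (w t * (2 * (c * -1))) t :=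
      ((((hasDerivAt_id t).const_sub b).const_mul c).const_mul 2).exp
    refine ⟨_, ?_, hw'.mul hv.norm_sq⟩
    calc w t * (2 * (c * -1)) * ‖z t‖ ^ 2 + w t * (2 * inner ℝ (z t) v)
        = 2 * w t * (inner ℝ (z t) v - c * ‖z t‖ ^ 2) := by ring
      _ ≤ 0 := mul_nonpos_of_nonneg_of_nonpos (by positivity) (sub_nonpos.2 hvz)
  refine (sq_le_sq₀ (norm_nonneg _) (by positivity)).1 ?_
  calc ‖z b‖ ^ 2 = w b * ‖z b‖ ^ 2 := by simp [w]
    _ ≤ w a * ‖z a‖ ^ 2 := hle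
    _ = (Real.exp (c * (b - a)) * ‖z a‖) ^ 2 := by rw [mul_pow, ← Real.exp_nat_mul]; rfl

lemma intervalIntegrable_of_locallyIntegrable {E : Type*} [NormedAddCommGroup E] {f : ℝ → E}
    {μ : Measure ℝ} (hf : LocallyIntegrable f μ) (a b : ℝ) : IntervalIntegrable f μ a b :=
  (hf.integrableOn_isCompact isCompact_uIcc).intervalIntegrable

lemma locallyIntegrable_indicator_Ioi {E : Type*} [NormedAddCommGroup E] {f : ℝ → E}
    {μ : Measure ℝ} {a : ℝ} (hf : LocallyIntegrableOn f (Ici a) μ) :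
    LocallyIntegrable ((Ioi a).indicator f) μ := by
  refine locallyIntegrable_iff.2 fun k hk => ?_
  rw [IntegrableOn, integrable_indicator_iff measurableSet_Ioi, IntegrableOn,
    Measure.restrict_restrict measurableSet_Ioi]
  exact (hf.integrableOn_compact_subset inter_subset_left (hk.inter_left isClosed_Ici)).mono_set
    (inter_subset_inter_left k Ioi_subset_Ici_self)

lemma aestronglyMeasurable_comp_of_continuous {α X Y : Type*} [MeasurableSpace α]
    [TopologicalSpace X] [TopologicalSpace Y] [TopologicalSpace.PseudoMetrizableSpace Y]
    [AddCommMonoid Y] [ContinuousAdd Y] {μ : Measure α} {G : α → X → Y}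
    (hG : ∀ a, Continuous (G a)) (hm : ∀ z, AEStronglyMeasurable (fun a => G a z) μ) {y : α → X}
    (hy : StronglyMeasurable y) : AEStronglyMeasurable (fun a => G a (y a)) μ := by
  refine aestronglyMeasurable_of_tendsto_ae atTop (f := fun n a => G a (hy.approx n a))
    (fun n => ?_) (.of_forall fun a => ((hG a).tendsto _).comp (hy.tendsto_approx a))
  have hsum : (fun a => G a (hy.approx n a)) = fun a => ∑ z ∈ (hy.approx n).range,
      (hy.approx n ⁻¹' {z}).indicator (fun a => G a z) a := by
    ext a
    rw [Finset.sum_eq_single_of_mem (hy.approx n a) (SimpleFunc.mem_range_self _ a)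
      fun z _ hz => indicator_of_notMem (fun h => hz h.symm) _]
    simp
  rw [hsum]
  exact Finset.aestronglyMeasurable_fun_sum _ fun z _ =>
    (hm z).indicator ((hy.approx n).measurableSet_preimage _)

lemma locallyIntegrable_comp_of_lipschitzWith {X E F : Type*} [TopologicalSpace X]
    [SecondCountableTopology X] [MeasurableSpace X] [OpensMeasurableSpace X]
    [NormedAddCommGroup E] [NormedAddCommGroup F] {μ : Measure X}
    [IsLocallyFiniteMeasure μ] {G : X → E → F} {K : ℝ≥0} (hL : ∀ t, LipschitzWith K (G t))
    (hG : ∀ z, LocallyIntegrable (fun t => G t z) μ) {y : X → E} (hy : Continuous y) :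
    LocallyIntegrable (fun t => G t (y t)) μ := by
  have hbound : LocallyIntegrable (fun t => ‖G t 0‖ + K * ‖y t‖) μ :=
    LocallyIntegrable.add (fun t => (hG 0 t).norm)
      (by fun_prop : Continuous fun t => K * ‖y t‖).locallyIntegrable
  refine hbound.mono (aestronglyMeasurable_comp_of_continuous (fun t => (hL t).continuous)
    (fun z => (hG z).aestronglyMeasurable) hy.stronglyMeasurable) (.of_forall fun t => ?_)
  calc ‖G t (y t)‖ ≤ ‖G t 0‖ + ‖G t (y t) - G t 0‖ := norm_le_norm_add_norm_sub' _ _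
    _ ≤ ‖G t 0‖ + K * ‖y t‖ := by
        gcongr
        simpa using (hL t).norm_sub_le (y t) 0
    _ ≤ ‖‖G t 0‖ + K * ‖y t‖‖ := le_abs_self _

end Analysis

section Volterra

variable {E : Type*} [NormedAddCommGroup E] {L : ℝ≥0} {Φ : C(ℝ, E) → C(ℝ, E)}

/-- Lipschitz operators of Volterra type: `Φ y t` depends on `y` only through its values between
`0` and `t`, in a Lipschitz way for the `L¹` norm. Their Picard iterates always converge. Time is
two-sided, and `Ι 0 t` is the interval between `0` and `t` for either sign of `t`. -/
def IsVolterraLipschitz (L : ℝ≥0) (Φ : C(ℝ, E) → C(ℝ, E)) : Prop :=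
  ∀ y z t, ‖Φ y t - Φ z t‖ ≤ L * ∫ s in Ι 0 t, ‖y s - z s‖

lemma IsVolterraLipschitz.norm_iterate_sub_le (hΦ : IsVolterraLipschitz L Φ) {y z : C(ℝ, E)}
    {R M : ℝ} (hyz : ∀ t, |t| ≤ R → ‖y t - z t‖ ≤ M) (n : ℕ) :
    ∀ t, |t| ≤ R → ‖Φ^[n] y t - Φ^[n] z t‖ ≤ M * ((L * |t|) ^ n / n !) := by
  induction n with
  | zero => simpa using hyz
  | succ n ih =>
    intro t ht
    have hmono : ∫ s in Ι 0 t, ‖Φ^[n] y s - Φ^[n] z s‖ ≤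
        ∫ s in Ι 0 t, M * L ^ n / n ! * |s - 0| ^ n := by
      refine setIntegral_mono_on (Continuous.integrableOn_uIoc (by fun_prop))
        (Continuous.integrableOn_uIoc (by fun_prop)) measurableSet_uIoc fun s hs => ?_
      have hst : |s| ≤ |t| := by simpa using abs_sub_left_of_mem_uIcc (uIoc_subset_uIcc hs)
      exact (ih s (hst.trans ht)).trans_eq (by rw [sub_zero]; ring)
    rw [iterate_succ_apply', iterate_succ_apply']
    calc ‖Φ (Φ^[n] y) t - Φ (Φ^[n] z) t‖
        ≤ L * ∫ s in Ι 0 t, M * L ^ n / n ! * |s - 0| ^ n := (hΦ _ _ t).trans (by gcongr)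
      _ = M * ((L * |t|) ^ (n + 1) / (n + 1)!) := by
          rw [integral_const_mul, integral_pow_abs_sub_uIoc, Nat.factorial_succ, sub_zero]
          push_cast
          field_simp
          ring

lemma IsVolterraLipschitz.continuous (hΦ : IsVolterraLipschitz L Φ) : Continuous Φ := by
  refine continuous_iff_continuousAt.2 fun y =>
    ContinuousMap.tendsto_iff_forall_isCompact_tendstoUniformlyOn.2 fun S hS =>
      Metric.tendstoUniformlyOn_iff.2 fun ε hε => ?_
  obtain ⟨R, hSR⟩ := hS.isBounded.subset_closedBall 0
  obtain ⟨δ, hδ, hδε⟩ : ∃ δ > 0, δ * (L * R) < ε :=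
    (exists_pos_mul_lt hε (L * R)).imp fun δ h => ⟨h.1, by linarith [h.2]⟩
  have hclose := Metric.tendstoUniformlyOn_iff.1
    (ContinuousMap.tendsto_iff_forall_isCompact_tendstoUniformlyOn.1 (tendsto_id (x := 𝓝 y)) _
      (isCompact_closedBall (0 : ℝ) R)) δ hδ
  filter_upwards [hclose] with z hz t ht
  have htR : |t| ≤ R := by simpa using hSR ht
  have hyz : ∀ s, |s| ≤ R → ‖y s - z s‖ ≤ δ := fun s hs => by
    simpa [dist_eq_norm] using (hz s (by simpa using hs)).le
  calc dist (Φ y t) (Φ z t) ≤ δ * (L * |t|) := by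
        simpa [dist_eq_norm] using hΦ.norm_iterate_sub_le hyz 1 t htR
    _ ≤ δ * (L * R) := by gcongr
    _ < ε := hδε

lemma IsVolterraLipschitz.summable_iterate_sub [CompleteSpace E] (hΦ : IsVolterraLipschitz L Φ)
    (y : C(ℝ, E)) : Summable fun n => Φ^[n + 1] y - Φ^[n] y := by
  refine ContinuousMap.summable_of_locally_summable_norm fun S => ?_
  obtain ⟨R, hR, hSR⟩ := S.isCompact.isBounded.subset_closedBall_lt 0 0
  obtain ⟨M, hM⟩ := (isCompact_closedBall (0 : ℝ) R).exists_bound_of_continuousOn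
    (map_continuous (Φ y - y)).continuousOn
  have hM0 : 0 ≤ M := (norm_nonneg _).trans (hM 0 (Metric.mem_closedBall_self hR.le))
  refine Summable.of_nonneg_of_le (fun _ => norm_nonneg _) (fun n => ?_)
    ((Real.summable_pow_div_factorial (L * R)).mul_left M)
  refine (ContinuousMap.norm_le _ (by positivity)).2 fun t => ?_
  have htR : |(t : ℝ)| ≤ R := by simpa using hSR t.2
  calc ‖Φ^[n] (Φ y) t - Φ^[n] y t‖ ≤ M * ((L * |(t : ℝ)|) ^ n / n !) :=
        hΦ.norm_iterate_sub_le (fun s hs => hM s (by simpa using hs)) n t htR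
    _ ≤ M * ((L * R) ^ n / n !) := by gcongr

lemma IsVolterraLipschitz.exists_isFixedPt [CompleteSpace E] (hΦ : IsVolterraLipschitz L Φ) :
    ∃ y, IsFixedPt Φ y := by
  have htends := (hΦ.summable_iterate_sub 0).hasSum.tendsto_sum_nat
  simp only [Finset.sum_range_sub (fun n => Φ^[n] 0), iterate_zero, id, sub_zero] at htends
  exact ⟨_, isFixedPt_of_tendsto_iterate htends hΦ.continuous.continuousAt⟩

end Volterra

section Regulator

variable {u v h : ℝ → ℝ} {s t C : ℝ}

/-- The regulator of the one-dimensional Skorokhod problem: the running supremum over `[0, t]` of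
the negative part of `u`, i.e. the least amount by which `u` has to be pushed upwards, in a
nondecreasing way, to remain nonnegative. For `t < 0` it is `sSup ∅ = 0`. -/
noncomputable def regulator (u : ℝ → ℝ) (t : ℝ) : ℝ := sSup ((fun s => (u s)⁻) '' Icc 0 t)

lemma regulator_nonneg (u : ℝ → ℝ) (t : ℝ) : 0 ≤ regulator u t :=
  Real.sSup_nonneg (forall_mem_image.2 fun s _ => negPart_nonneg (u s))

lemma regulator_le (hC : 0 ≤ C) (hu : ∀ s ∈ Icc 0 t, (u s)⁻ ≤ C) : regulator u t ≤ C :=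
  Real.sSup_le (forall_mem_image.2 hu) hC

lemma negPart_le_regulator (hu : Continuous u) (hs : s ∈ Icc 0 t) : (u s)⁻ ≤ regulator u t :=
  le_csSup (isCompact_Icc.image (continuous_negPart.comp hu)).bddAbove (mem_image_of_mem _ hs)

lemma add_regulator_nonneg (hu : Continuous u) (ht : 0 ≤ t) : 0 ≤ u t + regulator u t :=
  neg_le_iff_add_nonneg'.1 <|
    (neg_le_negPart _).trans (negPart_le_regulator hu (right_mem_Icc.2 ht))

lemma monotone_regulator (hu : Continuous u) : Monotone (regulator u) := fun _ t hst =>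
  regulator_le (regulator_nonneg u t) fun _ hr =>
    negPart_le_regulator hu ⟨hr.1, hr.2.trans hst⟩

lemma regulator_zero (hu : 0 ≤ u 0) : regulator u 0 = 0 := by
  simp [regulator, hu]

lemma negPart_le_negPart_add (a b : ℝ) : a⁻ ≤ b⁻ + |a - b| := by
  have h : |a⁻ - b⁻| ≤ |a - b| := by
    simpa [Real.dist_eq] using lipschitzWith_negPart.dist_le_mul a b
  linarith [le_abs_self (a⁻ - b⁻)]

lemma abs_regulator_sub_le (hu : Continuous u) (hv : Continuous v) (hC : 0 ≤ C)
    (huv : ∀ s ∈ Icc 0 t, |u s - v s| ≤ C) : |regulator u t - regulator v t| ≤ C := by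
  have hle : ∀ {p q : ℝ → ℝ}, Continuous q → (∀ s ∈ Icc 0 t, |p s - q s| ≤ C) →
      regulator p t ≤ C + regulator q t := fun {p q} hq hpq =>
    regulator_le (add_nonneg hC (regulator_nonneg _ t)) fun s hs => by
      linarith [negPart_le_negPart_add (p s) (q s), negPart_le_regulator hq hs, hpq s hs]
  refine abs_sub_le_iff.2 ⟨sub_le_iff_le_add.2 (hle hv huv), sub_le_iff_le_add.2 (hle hu ?_)⟩
  simpa only [abs_sub_comm] using huv

lemma regulator_sub_le (hu : Continuous u) (hu0 : 0 ≤ u 0)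
    (hinc : ∀ s t, s ≤ t → |u t - u s| ≤ h t - h s) (hst : s ≤ t) :
    regulator u t - regulator u s ≤ h t - h s := by
  have hmono : Monotone h := fun a b hab =>
    sub_nonneg.1 ((abs_nonneg _).trans (hinc a b hab))
  have hs : (u (max s 0))⁻ ≤ regulator u s := by
    rcases le_total s 0 with hs | hs
    · simpa [hs, hu0] using regulator_nonneg u s
    · simpa [hs] using negPart_le_regulator hu (right_mem_Icc.2 hs)
  rw [sub_le_iff_le_add']
  refine regulator_le (add_nonneg (regulator_nonneg u s) (sub_nonneg.2 (hmono hst))) fun r hr => ?_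
  rcases le_total r s with hrs | hsr
  · linarith [negPart_le_regulator hu ⟨hr.1, hrs⟩, hmono hst]
  · linarith [negPart_le_negPart_add (u r) (u (max s 0)), hinc _ r (max_le hsr hr.1),
      hmono hr.2, hmono (le_max_left s 0)]

lemma eq_zero_of_hasDerivAt_regulator (hu : Continuous u) {m : ℝ} (hpos : 0 < u t + regulator u t)
    (hm : HasDerivAt (regulator u) m t) : m = 0 := by
  have hev : ∀ᶠ s in 𝓝[≥] t, -u s < regulator u t :=
    ((hu.neg.tendsto t).eventually_lt_const
      (by simpa using neg_lt_iff_pos_add'.2 hpos)).filter_mono nhdsWithin_le_nhds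
  obtain ⟨b, htb, hb⟩ := mem_nhdsGE_iff_exists_Ico_subset.1 hev
  have hconst : ∀ᶠ s in 𝓝[≥] t, regulator u s = regulator u t := by
    filter_upwards [Ico_mem_nhdsGE htb] with s hs
    refine le_antisymm (regulator_le (regulator_nonneg u t) fun r hr => ?_)
      (monotone_regulator hu hs.1)
    rcases le_total r t with hrt | htr
    · exact negPart_le_regulator hu ⟨hr.1, hrt⟩
    · exact max_le (hb ⟨htr, hr.2.trans_lt hs.2⟩).le (regulator_nonneg u t)
  exact (uniqueDiffWithinAt_Ici t).eq_deriv _ hm.hasDerivWithinAt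
    ((hasDerivWithinAt_const t _ _).congr_of_eventuallyEq hconst rfl)

end Regulator

section Reflection

variable {d : ℕ} {u v : ℝ → EuclideanSpace ℝ (Fin d)} {t C : ℝ}

lemma norm_le_sqrt_mul {x : EuclideanSpace ℝ (Fin d)} (hC : 0 ≤ C) (hx : ∀ i, |x i| ≤ C) :
    ‖x‖ ≤ √d * C := by
  calc ‖x‖ = √(∑ i, |x i| ^ 2) := EuclideanSpace.norm_eq x
    _ ≤ √(∑ _i : Fin d, C ^ 2) := by gcongr with i; exact hx i
    _ = √d * C := by simp [Real.sqrt_sq hC]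

/-- The Skorokhod reflection of the path `u` at the boundary of the orthant: every coordinate of `u`
is pushed upwards by its own regulator. For `t < 0` it agrees with `u`. -/
noncomputable def reflection (u : ℝ → EuclideanSpace ℝ (Fin d)) (t : ℝ) :
    EuclideanSpace ℝ (Fin d) :=
  u t + WithLp.toLp 2 fun i => regulator (fun s => u s i) t

lemma reflection_apply (u : ℝ → EuclideanSpace ℝ (Fin d)) (t : ℝ) (i : Fin d) :
    reflection u t i = u t i + regulator (fun s => u s i) t := rfl

lemma reflection_mem_orthant (hu : Continuous u) (ht : 0 ≤ t) : reflection u t ∈ orthant d :=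
  fun i => add_regulator_nonneg (u := fun s => u s i) (by fun_prop) ht

lemma reflection_zero (hu0 : u 0 ∈ orthant d) : reflection u 0 = u 0 := by
  ext i
  rw [reflection_apply, regulator_zero (hu0 i), add_zero]

lemma norm_reflection_sub_le (hu : Continuous u) (hv : Continuous v)
    (huv : ∀ s ∈ uIcc 0 t, ‖u s - v s‖ ≤ C) : ‖reflection u t - reflection v t‖ ≤ 2 * √d * C := by
  have hcoord : ∀ i, ∀ s ∈ uIcc 0 t, |u s i - v s i| ≤ C := fun i s hs =>
    (PiLp.norm_apply_le (u s - v s) i).trans (huv s hs)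
  have hC : 0 ≤ C := (norm_nonneg _).trans (huv 0 left_mem_uIcc)
  rw [mul_comm 2, mul_assoc]
  refine norm_le_sqrt_mul (by positivity) fun i => ?_
  calc |reflection u t i - reflection v t i|
      = |(u t i - v t i) +
          (regulator (fun s => u s i) t - regulator (fun s => v s i) t)| := by
        rw [reflection_apply, reflection_apply, add_sub_add_comm]
    _ ≤ C + C := (abs_add_le _ _).trans <| add_le_add (hcoord i t right_mem_uIcc) <|
        abs_regulator_sub_le (by fun_prop) (by fun_prop) hC fun s hs =>
          hcoord i s (Icc_subset_uIcc hs)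
    _ = 2 * C := (two_mul C).symm

lemma dist_reflection_le (hu : Continuous u) (hu0 : u 0 ∈ orthant d) {h : ℝ → ℝ}
    (hinc : ∀ s t, s ≤ t → ‖u t - u s‖ ≤ h t - h s) (s t : ℝ) :
    dist (reflection u s) (reflection u t) ≤ 2 * √d * dist (h s) (h t) := by
  wlog hst : s ≤ t generalizing s t
  · simpa only [dist_comm] using this t s (le_of_not_ge hst)
  have hcoord : ∀ i s t, s ≤ t → |u t i - u s i| ≤ h t - h s := fun i s t hst =>
    (PiLp.norm_apply_le (u t - u s) i).trans (hinc s t hst)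
  have hh : 0 ≤ h t - h s := (norm_nonneg _).trans (hinc s t hst)
  rw [dist_comm, dist_comm (h s), dist_eq_norm, Real.dist_eq, abs_of_nonneg hh, mul_comm 2,
    mul_assoc]
  refine norm_le_sqrt_mul (by positivity) fun i => ?_
  have hreg : |regulator (fun s => u s i) t - regulator (fun s => u s i) s| ≤ h t - h s := by
    rw [abs_of_nonneg (sub_nonneg.2 (monotone_regulator (by fun_prop) hst))]
    exact regulator_sub_le (by fun_prop) (hu0 i) (hcoord i) hst
  calc |reflection u t i - reflection u s i|
      = |(u t i - u s i) +
          (regulator (fun s => u s i) t - regulator (fun s => u s i) s)| := by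
        rw [reflection_apply, reflection_apply, add_sub_add_comm]
    _ ≤ (h t - h s) + (h t - h s) :=
        (abs_add_le _ _).trans (add_le_add (hcoord i s t hst) hreg)
    _ = 2 * (h t - h s) := (two_mul _).symm

lemma continuous_reflection (hu : Continuous u) (hu0 : u 0 ∈ orthant d) {h : ℝ → ℝ}
    (hh : Continuous h) (hinc : ∀ s t, s ≤ t → ‖u t - u s‖ ≤ h t - h s) :
    Continuous (reflection u) := by
  refine continuous_iff_continuousAt.2 fun t => tendsto_iff_dist_tendsto_zero.2 <|
    squeeze_zero (fun _ => dist_nonneg) (fun s => dist_reflection_le hu hu0 hinc s t) ?_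
  simpa using (tendsto_iff_dist_tendsto_zero.1 (hh.tendsto t)).const_mul (2 * √d)

lemma neg_mem_normalCone_orthant {x m : EuclideanSpace ℝ (Fin d)} (hx : x ∈ orthant d)
    (hm : m ∈ orthant d) (hmx : ∀ i, 0 < x i → m i = 0) : -m ∈ normalCone (orthant d) x := by
  refine ⟨hx, fun y hy => ?_⟩
  rw [PiLp.inner_apply]
  refine Finset.sum_nonpos fun i _ => ?_
  have hcompl : m i * x i = 0 := by
    rcases (hx i).eq_or_lt with h | h
    · rw [← h, mul_zero]
    · rw [hmx i h, zero_mul]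
  simp only [PiLp.neg_apply, PiLp.sub_apply, RCLike.inner_apply, conj_trivial]
  linarith [mul_nonneg (hm i) (hy i)]

lemma hasDerivAt_reflection (hu : Continuous u) {v : EuclideanSpace ℝ (Fin d)} (ht : 0 ≤ t)
    (hv : HasDerivAt u v t)
    (hreg : ∀ i, DifferentiableAt ℝ (regulator fun s => u s i) t) :
    ∃ m, HasDerivAt (reflection u) (v + m) t ∧
      -m ∈ normalCone (orthant d) (reflection u t) := by
  have hpi : HasDerivAt (fun s i => regulator (fun r => u r i) s)
      (fun i => deriv (regulator fun r => u r i) t) t :=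
    hasDerivAt_pi.2 fun i => (hreg i).hasDerivAt
  refine ⟨WithLp.toLp 2 fun i => deriv (regulator fun r => u r i) t, hv.add <|
    (PiLp.continuousLinearEquiv 2 ℝ fun _ : Fin d => ℝ).symm.hasFDerivAt.comp_hasDerivAt t hpi,
    neg_mem_normalCone_orthant (reflection_mem_orthant hu ht) (fun i => ?_) fun i hi => ?_⟩
  · exact (monotone_regulator (by fun_prop)).deriv_nonneg
  · exact eq_zero_of_hasDerivAt_regulator (u := fun s => u s i) (by fun_prop) hi
      (hreg i).hasDerivAt

end Reflection

section FreePath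

variable {E : Type*} [NormedAddCommGroup E] [NormedSpace ℝ E] {f g : ℝ → E} {s t : ℝ}

/-- The path from `x₀` with velocity `-f`, that is, the solution in the absence of reflection. -/
noncomputable def freePath (x₀ : E) (f : ℝ → E) (t : ℝ) : E := x₀ - ∫ s in (0 : ℝ)..t, f s

lemma freePath_zero (x₀ : E) (f : ℝ → E) : freePath x₀ f 0 = x₀ := by
  simp [freePath]

lemma continuous_freePath (x₀ : E) (hf : LocallyIntegrable f) : Continuous (freePath x₀ f) :=
  continuous_const.sub
    (intervalIntegral.continuous_primitive (intervalIntegrable_of_locallyIntegrable hf) 0)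

lemma norm_freePath_sub_le (x₀ : E) (hf : LocallyIntegrable f) (hst : s ≤ t) :
    ‖freePath x₀ f t - freePath x₀ f s‖ ≤
      (∫ r in (0 : ℝ)..t, ‖f r‖) - ∫ r in (0 : ℝ)..s, ‖f r‖ := by
  have hint := intervalIntegrable_of_locallyIntegrable hf
  rw [freePath, freePath, sub_sub_sub_cancel_left, norm_sub_rev,
    intervalIntegral.integral_interval_sub_left (hint 0 t) (hint 0 s),
    intervalIntegral.integral_interval_sub_left (hint 0 t).norm (hint 0 s).norm]
  exact intervalIntegral.norm_integral_le_integral_norm hst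

lemma norm_freePath_sub_freePath_le (x₀ : E) (hf : LocallyIntegrable f) (hg : LocallyIntegrable g)
    (hs : s ∈ uIcc 0 t) :
    ‖freePath x₀ f s - freePath x₀ g s‖ ≤ ∫ r in Ι 0 t, ‖f r - g r‖ := by
  have hint := fun a b => intervalIntegrable_of_locallyIntegrable (hf.sub hg) a b
  rw [freePath, freePath, sub_sub_sub_cancel_left, norm_sub_rev, ← intervalIntegral.integral_sub
    (intervalIntegrable_of_locallyIntegrable hf 0 s)
    (intervalIntegrable_of_locallyIntegrable hg 0 s)]
  exact intervalIntegral.norm_integral_le_integral_norm_uIoc.trans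
    (setIntegral_mono_set ((hint 0 t).def'.norm) (.of_forall fun _ => norm_nonneg _)
      (LE.le.eventuallyLE (uIoc_subset_uIoc_of_uIcc_subset_uIcc (uIcc_subset_uIcc_left hs))))

lemma ae_hasDerivAt_freePath [CompleteSpace E] (x₀ : E) (hf : LocallyIntegrable f) :
    ∀ᵐ t, HasDerivAt (freePath x₀ f) (-f t) t := by
  filter_upwards [LocallyIntegrable.ae_hasDerivAt_integral hf] with t ht
  exact (ht 0).const_sub x₀

end FreePath

section Existence

variable {d : ℕ} {x₀ : EuclideanSpace ℝ (Fin d)}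

lemma isSolution_reflection_freePath
    {F : ℝ → EuclideanSpace ℝ (Fin d) → EuclideanSpace ℝ (Fin d)}
    {f : ℝ → EuclideanSpace ℝ (Fin d)} (hx₀ : x₀ ∈ orthant d) (hf : LocallyIntegrable f)
    (hfF : ∀ t, 0 < t → f t = F t (reflection (freePath x₀ f) t)) :
    IsSolution F x₀ (reflection (freePath x₀ f)) where
  absolutelyContinuous T _ :=
    have hprimitive := (intervalIntegrable_of_locallyIntegrable hf 0
      T).norm.absolutelyContinuousOnInterval_intervalIntegral left_mem_uIcc
    absolutelyContinuousOnInterval_of_dist_le hprimitive fun s _ t _ =>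
      dist_reflection_le (continuous_freePath x₀ hf) (by rwa [freePath_zero])
        (fun _ _ => norm_freePath_sub_le x₀ hf) s t
  inclusion := by
    have hcont := continuous_freePath x₀ hf
    have hreg : ∀ᵐ t, ∀ i, DifferentiableAt ℝ (regulator fun s => freePath x₀ f s i) t :=
      ae_all_iff.2 fun i => (monotone_regulator (by fun_prop)).ae_differentiableAt
    filter_upwards [ae_restrict_of_ae (ae_hasDerivAt_freePath x₀ hf), ae_restrict_of_ae hreg,
      ae_restrict_mem measurableSet_Ioi] with t hv hregt ht
    obtain ⟨m, hm, hmN⟩ := hasDerivAt_reflection hcont (mem_Ioi.1 ht).le hv hregt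
    exact ⟨_, hm, mem_add.2 ⟨-m, hmN, _, mem_singleton _, by rw [← hfF t ht]; abel⟩⟩
  initial := by
    rw [reflection_zero (by rwa [freePath_zero]), freePath_zero]

lemma exists_eq_reflection_freePath
    {G : ℝ → EuclideanSpace ℝ (Fin d) → EuclideanSpace ℝ (Fin d)} {K : ℝ≥0}
    (hL : ∀ t, LipschitzWith K (G t)) (hG : ∀ z, LocallyIntegrable fun t => G t z)
    (hx₀ : x₀ ∈ orthant d) :
    ∃ x : C(ℝ, EuclideanSpace ℝ (Fin d)), x = reflection (freePath x₀ fun t => G t (x t)) := by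
  have hint (y : C(ℝ, EuclideanSpace ℝ (Fin d))) : LocallyIntegrable fun t => G t (y t) :=
    locallyIntegrable_comp_of_lipschitzWith hL hG y.continuous
  have hfree (y : C(ℝ, EuclideanSpace ℝ (Fin d))) := continuous_freePath x₀ (hint y)
  let Φ (y : C(ℝ, EuclideanSpace ℝ (Fin d))) : C(ℝ, EuclideanSpace ℝ (Fin d)) :=
    ⟨reflection (freePath x₀ fun t => G t (y t)),
      continuous_reflection (hfree y) (by rwa [freePath_zero])
        (intervalIntegral.continuous_primitive
          (fun a b => (intervalIntegrable_of_locallyIntegrable (hint y) a b).norm) 0)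
        fun _ _ => norm_freePath_sub_le x₀ (hint y)⟩
  have hΦ : IsVolterraLipschitz (2 * NNReal.sqrt d * K) Φ := fun y z t => by
    calc ‖Φ y t - Φ z t‖ ≤ 2 * √d * ∫ s in Ι 0 t, ‖G s (y s) - G s (z s)‖ :=
          norm_reflection_sub_le (hfree y) (hfree z) fun s hs =>
            norm_freePath_sub_freePath_le x₀ (hint y) (hint z) hs
      _ ≤ 2 * √d * ∫ s in Ι 0 t, K * ‖y s - z s‖ := by
          gcongr ?_ * ?_
          exact setIntegral_mono
            (intervalIntegrable_of_locallyIntegrable ((hint y).sub (hint z)) 0 t).def'.norm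
            (Continuous.integrableOn_uIoc (by fun_prop)) fun s => (hL s).norm_sub_le _ _
      _ = (2 * NNReal.sqrt d * K : ℝ≥0) * ∫ s in Ι 0 t, ‖y s - z s‖ := by
          rw [integral_const_mul]
          push_cast
          ring
  obtain ⟨x, hx⟩ := hΦ.exists_isFixedPt
  exact ⟨x, congrArg DFunLike.coe hx.eq.symm⟩

lemma exists_isSolution {F : ℝ → EuclideanSpace ℝ (Fin d) → EuclideanSpace ℝ (Fin d)} {K : ℝ≥0}
    (hL : ∀ t, 0 < t → LipschitzWith K (F t))
    (hF : ∀ z, LocallyIntegrableOn (fun t => F t z) (Ici 0)) (hx₀ : x₀ ∈ orthant d) :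
    ∃ x, IsSolution F x₀ x ∧ ∀ t, 0 ≤ t → x t ∈ orthant d := by
  let G (t : ℝ) (z : EuclideanSpace ℝ (Fin d)) := (Ioi 0).indicator (fun s => F s z) t
  have hGpos : ∀ t, 0 < t → G t = F t := fun t ht => funext fun z => indicator_of_mem ht _
  have hGL : ∀ t, LipschitzWith K (G t) := fun t => by
    rcases le_or_gt t 0 with ht | ht
    · have hG0 : G t = fun _ => 0 := funext fun z => indicator_of_notMem (notMem_Ioi.2 ht) _
      exact hG0 ▸ LipschitzWith.const' 0
    · exact hGpos t ht ▸ hL t ht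
  have hGi : ∀ z, LocallyIntegrable fun t => G t z := fun z =>
    locallyIntegrable_indicator_Ioi (hF z)
  obtain ⟨x, hx⟩ := exists_eq_reflection_freePath hGL hGi hx₀
  have hf := locallyIntegrable_comp_of_lipschitzWith hGL hGi x.continuous
  refine ⟨reflection (freePath x₀ fun t => G t (x t)), isSolution_reflection_freePath hx₀ hf
    fun t ht => ?_, fun t ht => reflection_mem_orthant (continuous_freePath x₀ hf) ht⟩
  rw [← hx, hGpos t ht]

end Existence

section Uniqueness

lemma neg_mul_norm_sq_le_inner_of_lipschitzWith {E : Type*} [NormedAddCommGroup E]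
    [InnerProductSpace ℝ E] {f : E → E} {K : ℝ≥0} (hf : LipschitzWith K f) (x y : E) :
    -(K * ‖x - y‖ ^ 2) ≤ inner ℝ (f x - f y) (x - y) := by
  refine neg_le_of_abs_le ((abs_real_inner_le_norm _ _).trans ?_)
  calc ‖f x - f y‖ * ‖x - y‖ ≤ K * ‖x - y‖ * ‖x - y‖ := by
        gcongr
        exact hf.norm_sub_le x y
    _ = K * ‖x - y‖ ^ 2 := by ring

variable {d : ℕ}

lemma inner_sub_nonneg_of_mem_normalCone {S : Set (EuclideanSpace ℝ (Fin d))}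
    {x y ξ η : EuclideanSpace ℝ (Fin d)} (hξ : ξ ∈ normalCone S x) (hη : η ∈ normalCone S y) :
    0 ≤ inner ℝ (ξ - η) (x - y) := by
  have hξy := hξ.2 y hη.1
  have hηx := hη.2 x hξ.1
  rw [← neg_sub x y, inner_neg_right] at hξy
  rw [inner_sub_left]
  linarith

lemma inner_velocity_sub_le {S : Set (EuclideanSpace ℝ (Fin d))}
    {x y v w a b : EuclideanSpace ℝ (Fin d)} {c : ℝ}
    (hab : -(c * ‖x - y‖ ^ 2) ≤ inner ℝ (a - b) (x - y))
    (hv : -v ∈ normalCone S x + {a}) (hw : -w ∈ normalCone S y + {b}) :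
    inner ℝ (x - y) (v - w) ≤ c * ‖x - y‖ ^ 2 := by
  have hξ : -v - a ∈ normalCone S x := by simpa [sub_eq_add_neg] using hv
  have hη : -w - b ∈ normalCone S y := by simpa [sub_eq_add_neg] using hw
  have hvw : v - w = -((-v - a) - (-w - b)) - (a - b) := by abel
  rw [hvw, real_inner_comm, inner_sub_left, inner_neg_left]
  linarith [inner_sub_nonneg_of_mem_normalCone hξ hη]

variable {F : ℝ → EuclideanSpace ℝ (Fin d) → EuclideanSpace ℝ (Fin d)} {c : ℝ}
  {x₀ y₀ : EuclideanSpace ℝ (Fin d)} {x y : ℝ → EuclideanSpace ℝ (Fin d)}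

lemma IsSolution.norm_sub_le (hF : ∀ t, 0 < t → ∀ x y,
      -(c * ‖x - y‖ ^ 2) ≤ inner ℝ (F t x - F t y) (x - y))
    (hx : IsSolution F x₀ x) (hy : IsSolution F y₀ y) {T : ℝ} (hT : 0 ≤ T) :
    ‖x T - y T‖ ≤ Real.exp (c * T) * ‖x₀ - y₀‖ := by
  rcases hT.eq_or_lt with rfl | hT
  · simp [hx.initial, hy.initial]
  have hdiff : AbsolutelyContinuousOnInterval (fun t => x t - y t) 0 T :=
    (hx.absolutelyContinuous T hT).fun_sub (hy.absolutelyContinuous T hT)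
  have hgrowth : ∀ᵐ t ∂volume.restrict (Ioc 0 T), ∃ v, HasDerivAt (fun t => x t - y t) v t ∧
      inner ℝ (x t - y t) v ≤ c * ‖x t - y t‖ ^ 2 := by
    filter_upwards [ae_restrict_of_ae_restrict_of_subset Ioc_subset_Ioi_self hx.inclusion,
      ae_restrict_of_ae_restrict_of_subset Ioc_subset_Ioi_self hy.inclusion,
      ae_restrict_mem measurableSet_Ioc] with t ⟨v, hv, hvN⟩ ⟨w, hw, hwN⟩ ht
    exact ⟨v - w, hv.sub hw, inner_velocity_sub_le (hF t ht.1 _ _) hvN hwN⟩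
  simpa [hx.initial, hy.initial] using
    norm_le_exp_mul_norm_of_ae_inner_deriv_le hT.le hdiff hgrowth

lemma IsSolution.eqOn (hF : ∀ t, 0 < t → ∀ x y,
      -(c * ‖x - y‖ ^ 2) ≤ inner ℝ (F t x - F t y) (x - y))
    (hx : IsSolution F x₀ x) (hy : IsSolution F x₀ y) : EqOn x y (Ici 0) := fun t ht => by
  simpa [sub_eq_zero] using hx.norm_sub_le hF hy ht

end Uniqueness

section Forcing

variable {d : ℕ} {σ : ℝ → ℝ} {K : ℝ≥0}

lemma lipschitzWith_act (hσ : LipschitzWith K σ) : LipschitzWith K (act (d := d) σ) := by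
  refine LipschitzWith.of_dist_le_mul fun x y => ?_
  calc dist (act σ x) (act σ y) = √(∑ i, dist (σ (x i)) (σ (y i)) ^ 2) :=
        EuclideanSpace.dist_eq _ _
    _ ≤ √(∑ i, (K * dist (x i) (y i)) ^ 2) := by
        gcongr with i
        exact hσ.dist_le_mul (x i) (y i)
    _ = √(K ^ 2 * ∑ i, dist (x i) (y i) ^ 2) := by simp only [mul_pow, Finset.mul_sum]
    _ = K * dist x y := by
        rw [Real.sqrt_mul (sq_nonneg _), Real.sqrt_sq K.coe_nonneg, EuclideanSpace.dist_eq]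

lemma lipschitzWith_forcing {A₁ A₂ : ℝ → Matrix (Fin d) (Fin d) ℝ}
    (b₁ b₂ : ℝ → EuclideanSpace ℝ (Fin d)) (hσ : LipschitzWith K σ) (t : ℝ) :
    LipschitzWith (‖op (A₂ t)‖₊ * (K * ‖op (A₁ t)‖₊)) (forcing A₁ A₂ b₁ b₂ σ t) := by
  have hinner : LipschitzWith ‖op (A₁ t)‖₊ fun x => op (A₁ t) x + b₁ t := by
    simpa using (op (A₁ t)).lipschitz.add (LipschitzWith.const (b₁ t))
  have houter := (op (A₂ t)).lipschitz.comp ((lipschitzWith_act hσ).comp hinner)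
  simpa using! houter.sub (LipschitzWith.const (b₂ t))

end Forcing

end ResNet

theorem theorem1_general (d : ℕ) (K : ℝ≥0)
    (F : ℝ → EuclideanSpace ℝ (Fin d) → EuclideanSpace ℝ (Fin d))
    (hL : ∀ t, 0 < t → LipschitzWith K (F t))
    (hF : ∀ z, LocallyIntegrableOn (fun t => F t z) (Ici 0))
    (x₀ : EuclideanSpace ℝ (Fin d)) (hx₀ : x₀ ∈ ResNet.orthant d) :
    ∃ x : ℝ → EuclideanSpace ℝ (Fin d),
      ResNet.IsSolution F x₀ x ∧ (∀ t, 0 ≤ t → x t ∈ ResNet.orthant d) ∧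
      ∀ y : ℝ → EuclideanSpace ℝ (Fin d), ResNet.IsSolution F x₀ y → EqOn y x (Ici 0) := by
  obtain ⟨x, hx, hmem⟩ := ResNet.exists_isSolution hL hF hx₀
  exact ⟨x, hx, hmem, fun y hy => hy.eqOn
    (fun t ht => ResNet.neg_mul_norm_sq_le_inner_of_lipschitzWith (hL t ht)) hx⟩

theorem theorem1 (d : ℕ) (c : ℝ) (hc : 0 < c)
    (A₁ A₂ : ℝ → Matrix (Fin d) (Fin d) ℝ) (b₁ b₂ : ℝ → EuclideanSpace ℝ (Fin d))
    (σ : ℝ → ℝ)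
    (hA : ∀ t : ℝ, 0 < t → ‖ResNet.op (A₁ t)‖ * ‖ResNet.op (A₂ t)‖ ≤ c)
    (hσ : LipschitzWith 1 σ) (hσ0 : σ 0 = 0)
    (hF : ∀ z : EuclideanSpace ℝ (Fin d),
      LocallyIntegrableOn (fun t => ResNet.forcing A₁ A₂ b₁ b₂ σ t z) (Ici (0 : ℝ)) volume)
    (x₀ : EuclideanSpace ℝ (Fin d)) (hx₀ : x₀ ∈ ResNet.orthant d) :
    ∃ x : ℝ → EuclideanSpace ℝ (Fin d),
      ResNet.IsSolution (ResNet.forcing A₁ A₂ b₁ b₂ σ) x₀ x ∧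
      (∀ t : ℝ, 0 ≤ t → x t ∈ ResNet.orthant d) ∧
      ∀ y : ℝ → EuclideanSpace ℝ (Fin d),
        ResNet.IsSolution (ResNet.forcing A₁ A₂ b₁ b₂ σ) x₀ y → EqOn y x (Ici (0 : ℝ)) := by
  refine theorem1_general d ⟨c, hc.le⟩ _ (fun t ht => ?_) hF x₀ hx₀
  exact (ResNet.lipschitzWith_forcing b₁ b₂ hσ t).weaken (by simpa [mul_comm] using! hA t ht)
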